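/- Fix $\sigma\in(0,\sqrt{\pi/2})$, put $w=\sigma+it$ and $u_t=(\sigma+it)^2$ for $t\in\mathbb{R}$, and use principal branches of logarithms and powers. For $z,\tau\in\mathbb{C}$ define $$R(z)=\int_{-\infty}^{\infty} w^{2z}\frac{e^{w^2}}{1-e^{w^2}}\,dt,\qquad D(z)=\int_{-\infty}^{\infty} w^{2z}\frac{e^{w^2}}{1+e^{w^2}}\,dt,$$ $$S(z)=\tfrac12\bigl[R(z)-R(-z)+D(z)-D(-z)\bigr],\qquad \mathcal{X}(\tau)=\int_{-\infty}^{\infty}\frac{\sin(\tau\log u_t)}{\sinh(u_t)}\,dt.$$ All these integrals converge absolutely, for all complex $z$ and $\tau$, and $$\mathcal{X}(\tau)=i\,S(i\tau)\qquad\text{for all }\tau\in\mathbb{C}.$$ Consequently, if every root $\tau\in\mathbb{C}$ of $\mathcal{X}(\tau)=0$ with $|\operatorname{Im}\tau|<\tfrac12$ is real, then the Riemann Hypothesis is true. -/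

import Mathlib

noncomputable section

namespace ParabolicMellin

/-- The point `w = σ + it` of the vertical line of abscissa `σ`. -/
def w (σ t : ℝ) : ℂ := (σ : ℂ) + (t : ℂ) * Complex.I

/-- The point `u_t = (σ + it)²` of the parabolic contour. -/
def u (σ t : ℝ) : ℂ := w σ t ^ 2

/-- The integrand of `R(z)`, namely `w^{2z} e^{w²} / (1 - e^{w²})` (principal branch of the power). -/
def integrandR (σ : ℝ) (z : ℂ) (t : ℝ) : ℂ :=
  w σ t ^ (2 * z) * (Complex.exp (w σ t ^ 2) / (1 - Complex.exp (w σ t ^ 2)))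

/-- The integrand of `D(z)`, namely `w^{2z} e^{w²} / (1 + e^{w²})` (principal branch of the power). -/
def integrandD (σ : ℝ) (z : ℂ) (t : ℝ) : ℂ :=
  w σ t ^ (2 * z) * (Complex.exp (w σ t ^ 2) / (1 + Complex.exp (w σ t ^ 2)))

/-- The integrand of `𝒳(τ)`, namely `sin(τ log u_t) / sinh(u_t)` (principal branch of the log). -/
def integrandX (σ : ℝ) (τ : ℂ) (t : ℝ) : ℂ :=
  Complex.sin (τ * Complex.log (u σ t)) / Complex.sinh (u σ t)

/-- `R(z) = ∫ w^{2z} e^{w²} / (1 - e^{w²}) dt`. -/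
def R (σ : ℝ) (z : ℂ) : ℂ := ∫ t : ℝ, integrandR σ z t

/-- `D(z) = ∫ w^{2z} e^{w²} / (1 + e^{w²}) dt`. -/
def D (σ : ℝ) (z : ℂ) : ℂ := ∫ t : ℝ, integrandD σ z t

/-- The symmetric difference `S(z) = ½ [R(z) - R(-z) + D(z) - D(-z)]`. -/
def S (σ : ℝ) (z : ℂ) : ℂ := (1 / 2) * (R σ z - R σ (-z) + D σ z - D σ (-z))

/-- `𝒳(τ) = ∫ sin(τ log u_t) / sinh(u_t) dt`. -/
def X (σ : ℝ) (τ : ℂ) : ℂ := ∫ t : ℝ, integrandX σ τ t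

end ParabolicMellin

end

open Complex MeasureTheory Filter Topology

namespace ParabolicMellin

/-! Everything reduces to K(z) = ∫ w^{2z} / sinh(w²) dt, named `kernelIntegral`. With x = w², the
identity e^x/(1-e^x) + e^x/(1+e^x) = -1/sinh x gives R + D = -K, so S(z) = (K(-z) - K(z))/2.
Expanding the sine into exponentials expresses 𝒳 through K as well (`X_eq`).

The key fact is `kernelIntegral_eq_zeta`: K(z) is ζ(z + 1/2) times the factor -2π (1 - 2^{-(z+1/2)})
/ Γ(1/2 - z). For Re z > 1 the contour moves to the imaginary axis, where K becomes a Mellin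
transform of 1/sinh times cos(πz), and Euler's reflection formula removes the cosine. As K is
entire, the identity theorem extends this to all z ≠ 1/2.

A zero s of ζ in the critical strip has the companion zero 1 - s, so K vanishes at both s - 1/2 and
1/2 - s, and 𝒳 vanishes at τ = -i(s - 1/2). Since Im τ = 1/2 - Re s, reality of τ puts s on the
critical line. -/

/-- The integrand `w^{2z} / sinh (w²)` as a function of the complex variable `w`. -/
noncomputable def kernel (z w : ℂ) : ℂ := w ^ (2 * z) / sinh (w ^ 2)

/-! ### Lower bounds for sinh(v²) in the strip -/

theorem sinh_sq_ne_zero {v : ℂ} (h0 : 0 ≤ v.re) (h1 : v.re < √(Real.pi / 2)) (hv : v ≠ 0) :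
    sinh (v ^ 2) ≠ 0 := by
  intro h
  have hexp : exp (2 * v ^ 2) = 1 := by
    have h2 : exp (v ^ 2) = exp (-v ^ 2) := by
      rw [Complex.sinh, div_eq_zero_iff] at h
      rcases h with h | h
      · exact sub_eq_zero.1 h
      · norm_num at h
    rw [two_mul, exp_add]
    nth_rw 2 [h2]
    rw [← exp_add]; simp
  obtain ⟨n, hn⟩ := exp_eq_one_iff.1 hexp
  have hre := congrArg re hn
  have him := congrArg im hn
  simp [pow_two] at hre him
  -- A zero means v² = nπi, hence |n|π = 2 (Re v)² < π. The bound on σ is exactly what forces n = 0.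
  have hsq : v.re ^ 2 < Real.pi / 2 := by
    have := (Real.lt_sqrt h0).1 h1
    exact this
  have h3 : v.re ^ 2 = v.im ^ 2 := by nlinarith
  have h4 : 2 * (v.re * v.im) = n * Real.pi := by linarith
  have hpi := Real.pi_pos
  have h5 : ((n : ℝ) * Real.pi) ^ 2 = (2 * v.re ^ 2) ^ 2 := by
    rw [← h4]
    have : (2 * (v.re * v.im)) ^ 2 = 4 * v.re ^ 2 * v.im ^ 2 := by ring
    rw [this, ← h3]; ring
  have h6 : ((n : ℝ) * Real.pi) ^ 2 < Real.pi ^ 2 := by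
    rw [h5]
    exact pow_lt_pow_left₀ (by linarith) (by positivity) two_ne_zero
  have h7 : (n : ℝ) ^ 2 < 1 := by
    have : (n : ℝ) ^ 2 * Real.pi ^ 2 < 1 * Real.pi ^ 2 := by nlinarith
    exact lt_of_mul_lt_mul_right this (by positivity)
  have h8 : n = 0 := by
    have : n ^ 2 < 1 := by exact_mod_cast h7
    nlinarith
  rw [h8] at h5
  have hr : v.re = 0 := by
    have : (2 * v.re ^ 2) ^ 2 = 0 := by rw [← h5]; simp
    simpa using this
  have hi : v.im = 0 := by
    rw [hr] at h3; simpa using h3.symm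
  exact hv (Complex.ext hr hi)

theorem abs_sinh_re_le_norm_sinh (v : ℂ) : |Real.sinh v.re| ≤ ‖sinh v‖ := by
  have h := abs_norm_sub_norm_le (exp v) (exp (-v))
  rw [norm_exp, norm_exp] at h
  rw [Complex.sinh, Real.sinh_eq, norm_div, abs_div]
  simp only [neg_re] at h
  norm_num
  linarith

/-- Compactness: sinh(v²)/v², extended over 0 by `dslope`, is continuous and zero-free on the
rectangle. -/
theorem exists_mul_norm_sq_le_norm_sinh {σ : ℝ} (hσ : σ < √(Real.pi / 2)) (T : ℝ) :
    ∃ m : ℝ, 0 < m ∧ ∀ v : ℂ, 0 ≤ v.re → v.re ≤ σ → |v.im| ≤ T →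
      m * ‖v‖ ^ 2 ≤ ‖sinh (v ^ 2)‖ := by
  have hcont : Continuous (dslope sinh 0) := by
    rw [← continuousOn_univ, continuousOn_dslope univ_mem]
    exact ⟨continuous_sinh.continuousOn, differentiable_sinh 0⟩
  have hK : IsCompact (Set.Icc 0 σ ×ℂ Set.Icc (-T) T) := isCompact_Icc.reProdIm isCompact_Icc
  have hpos : ∀ v ∈ Set.Icc 0 σ ×ℂ Set.Icc (-T) T, 0 < ‖dslope sinh 0 (v ^ 2)‖ := by
    intro v hv
    rw [mem_reProdIm] at hv
    rw [norm_pos_iff]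
    by_cases h : v = 0
    · simp [h, dslope_same]
    · rw [dslope_of_ne _ (pow_ne_zero 2 h), slope_def_field]
      simp only [sinh_zero, sub_zero]
      exact div_ne_zero (sinh_sq_ne_zero hv.1.1 (hv.1.2.trans_lt hσ) h) (pow_ne_zero 2 h)
  have hc : ContinuousOn (fun v : ℂ => ‖dslope sinh 0 (v ^ 2)‖)
      (Set.Icc 0 σ ×ℂ Set.Icc (-T) T) :=
    (hcont.comp (continuous_pow 2)).norm.continuousOn
  obtain ⟨m, hm, hle⟩ := hK.exists_forall_le' hc hpos
  refine ⟨m, hm, fun v h0 h1 h2 => ?_⟩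
  have := hle v (by rw [mem_reProdIm]; exact ⟨⟨h0, h1⟩, abs_le.1 h2⟩)
  have heq : sinh (v ^ 2) = v ^ 2 * dslope sinh 0 (v ^ 2) := by
    have := sub_smul_dslope sinh 0 (v ^ 2)
    simpa using this.symm
  rw [heq, norm_mul, norm_pow, mul_comm]
  gcongr

/-- Far from the real axis Re(v²) is very negative, so |sinh(v²)| grows like exp((Im v)²). Half of
that Gaussian absorbs ‖v‖², the other half is kept. -/
theorem norm_sq_le_sinh_of_large {σ : ℝ} {v : ℂ} (h0 : 0 ≤ v.re) (h1 : v.re ≤ σ)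
    (h2 : σ ^ 2 + 1 ≤ v.im ^ 2) :
    ‖v‖ ^ 2 ≤ 4 * Real.exp (σ ^ 2) * (σ ^ 2 + 2) * Real.exp (-v.im ^ 2 / 2) * ‖sinh (v ^ 2)‖ := by
  have hre : v.re ^ 2 ≤ σ ^ 2 := pow_le_pow_left₀ h0 h1 2
  have hsq : (v ^ 2).re = -(v.im ^ 2 - v.re ^ 2) := by simp [pow_two]
  have hs := abs_sinh_re_le_norm_sinh (v ^ 2)
  rw [hsq, Real.sinh_neg, abs_neg] at hs
  set y := v.im ^ 2 - v.re ^ 2 with hy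
  have hy1 : 1 ≤ y := by linarith
  have hs2 : Real.exp y / 4 ≤ ‖sinh (v ^ 2)‖ := by
    refine le_trans ?_ ((le_abs_self _).trans hs)
    rw [Real.sinh_eq]
    have e1 := Real.add_one_le_exp y
    have e2 : Real.exp (-y) ≤ 1 := Real.exp_le_one_iff.2 (by linarith)
    linarith
  have hs3 : Real.exp (v.im ^ 2 - σ ^ 2) / 4 ≤ ‖sinh (v ^ 2)‖ :=
    le_trans (by gcongr; linarith) hs2
  have hn : ‖v‖ ^ 2 = v.re ^ 2 + v.im ^ 2 := by
    rw [Complex.sq_norm, normSq_apply]; ring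
  have e3 := Real.add_one_le_exp (v.im ^ 2 / 2)
  have e4 : 1 ≤ Real.exp (v.im ^ 2 / 2) := Real.one_le_exp (by positivity)
  calc ‖v‖ ^ 2 ≤ (σ ^ 2 + 2) * Real.exp (v.im ^ 2 / 2) := by
        rw [hn]; nlinarith [sq_nonneg σ]
    _ = 4 * Real.exp (σ ^ 2) * (σ ^ 2 + 2) * Real.exp (-v.im ^ 2 / 2) *
          (Real.exp (v.im ^ 2 - σ ^ 2) / 4) := by
        have : Real.exp (v.im ^ 2 / 2) =
            Real.exp (σ ^ 2) * Real.exp (-v.im ^ 2 / 2) * Real.exp (v.im ^ 2 - σ ^ 2) := by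
          rw [← Real.exp_add, ← Real.exp_add]; congr 1; ring
        rw [this]; ring
    _ ≤ _ := by gcongr

theorem exists_norm_sq_le_norm_sinh {σ : ℝ} (hσ : σ < √(Real.pi / 2)) :
    ∃ C : ℝ, 0 < C ∧ ∀ v : ℂ, 0 ≤ v.re → v.re ≤ σ →
      ‖v‖ ^ 2 ≤ C * Real.exp (-v.im ^ 2 / 2) * ‖sinh (v ^ 2)‖ := by
  obtain ⟨m, hm, hle⟩ := exists_mul_norm_sq_le_norm_sinh hσ √(σ ^ 2 + 1)
  refine ⟨max (4 * Real.exp (σ ^ 2) * (σ ^ 2 + 2)) (m⁻¹ * Real.exp ((σ ^ 2 + 1) / 2)),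
    lt_max_of_lt_left (by positivity), fun v h0 h1 => ?_⟩
  rcases le_total (σ ^ 2 + 1) (v.im ^ 2) with h | h
  · refine (norm_sq_le_sinh_of_large h0 h1 h).trans ?_
    gcongr
    exact le_max_left _ _
  · have hb := hle v h0 h1 (Real.abs_le_sqrt h)
    calc ‖v‖ ^ 2 = m⁻¹ * 1 * (m * ‖v‖ ^ 2) := by field_simp
      _ ≤ m⁻¹ * (Real.exp ((σ ^ 2 + 1) / 2) * Real.exp (-v.im ^ 2 / 2)) * ‖sinh (v ^ 2)‖ := by
          gcongr
          rw [← Real.exp_add]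
          exact Real.one_le_exp (by linarith)
      _ = m⁻¹ * Real.exp ((σ ^ 2 + 1) / 2) * Real.exp (-v.im ^ 2 / 2) * ‖sinh (v ^ 2)‖ := by ring
      _ ≤ _ := by
          gcongr
          exact le_max_right _ _

/-! ### Gaussian decay of the kernel -/

theorem norm_log_le_of_re {v : ℂ} {σ : ℝ} (hσ : 0 < σ) (h : v.re = σ) :
    ‖log v‖ ≤ (σ + |Real.log σ| + Real.pi) + |v.im| := by
  have hnorm : σ ≤ ‖v‖ := by rw [← h]; exact re_le_norm v
  have hnorm' : ‖v‖ ≤ σ + |v.im| := by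
    have := norm_le_abs_re_add_abs_im v
    rwa [h, abs_of_pos hσ] at this
  have hv : 0 < ‖v‖ := hσ.trans_le hnorm
  have h1 : |Real.log ‖v‖| ≤ σ + |v.im| + |Real.log σ| := by
    rw [abs_le]
    constructor
    · have := Real.log_le_log hσ hnorm
      have := neg_abs_le (Real.log σ)
      have := abs_nonneg v.im
      linarith
    · have := Real.log_le_sub_one_of_pos hv
      have := abs_nonneg (Real.log σ)
      linarith
  have h2 := norm_le_abs_re_add_abs_im (log v)
  rw [log_re, log_im] at h2
  have := abs_arg_le_pi v
  linarith

theorem exp_mul_abs_le (a x : ℝ) : Real.exp (a * |x|) ≤ Real.exp (a ^ 2) * Real.exp (x ^ 2 / 4) := by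
  rw [← Real.exp_add, Real.exp_le_exp]
  nlinarith [sq_nonneg (a - |x| / 2), sq_abs x]

theorem norm_cpow_le_exp {v : ℂ} (hv : v ≠ 0) (z : ℂ) : ‖v ^ z‖ ≤ Real.exp (‖log v‖ * ‖z‖) := by
  rw [cpow_def_of_ne_zero hv, ← norm_mul]
  exact norm_exp_le_exp_norm _

/-- On a vertical line of positive abscissa the kernel and its logarithmic multiple have
Gaussian decay, locally uniformly in the exponent. -/
theorem exists_norm_kernel_le {σ : ℝ} (h0 : 0 < σ) (hσ : σ < √(Real.pi / 2)) (A : ℝ) :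
    ∃ C : ℝ, ∀ z : ℂ, ‖z‖ ≤ A → ∀ v : ℂ, v.re = σ →
      ‖log v‖ * ‖kernel z v‖ ≤ C * Real.exp (-(1 / 4) * v.im ^ 2) ∧
      ‖kernel z v‖ ≤ C * Real.exp (-(1 / 4) * v.im ^ 2) := by
  obtain ⟨C, hC, hle⟩ := exists_norm_sq_le_norm_sinh hσ
  set c := σ + |Real.log σ| + Real.pi with hc
  -- 2A bounds the exponent 2z; the extra 1 pays for the factor ‖log v‖ ≤ exp ‖log v‖.
  set a := 2 * A + 1 with ha
  refine ⟨C / σ ^ 2 * Real.exp (c * a) * Real.exp (a ^ 2), fun z hz v hv => ?_⟩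
  have hA : 0 ≤ A := (norm_nonneg z).trans hz
  have hnorm : σ ≤ ‖v‖ := by rw [← hv]; exact re_le_norm v
  have hv0 : v ≠ 0 := norm_pos_iff.1 (h0.trans_le hnorm)
  have hs := sinh_sq_ne_zero (by rw [hv]; exact h0.le) (by rwa [hv]) hv0
  have hinv : ‖sinh (v ^ 2)‖⁻¹ ≤ C / σ ^ 2 * Real.exp (-v.im ^ 2 / 2) := by
    rw [inv_le_iff_one_le_mul₀ (norm_pos_iff.2 hs)]
    have h1 := hle v (by rw [hv]; exact h0.le) hv.le
    have h2 : σ ^ 2 ≤ ‖v‖ ^ 2 := pow_le_pow_left₀ h0.le hnorm 2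
    have : 0 < σ ^ 2 := by positivity
    calc 1 = σ ^ 2 / σ ^ 2 := by field_simp
      _ ≤ C * Real.exp (-v.im ^ 2 / 2) * ‖sinh (v ^ 2)‖ / σ ^ 2 := by gcongr; exact h2.trans h1
      _ = _ := by ring
  have hlog := norm_log_le_of_re h0 hv
  have hL0 := norm_nonneg (log v)
  have hexp : Real.exp (‖log v‖ * a) ≤
      Real.exp (c * a) * (Real.exp (a ^ 2) * Real.exp (v.im ^ 2 / 4)) := by
    refine le_trans ?_ (mul_le_mul_of_nonneg_left (exp_mul_abs_le a v.im) (Real.exp_pos _).le)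
    rw [← Real.exp_add, Real.exp_le_exp]
    have : 0 ≤ a := by positivity
    nlinarith
  have hpow : ‖v ^ (2 * z)‖ ≤ Real.exp (‖log v‖ * (2 * A)) := by
    refine (norm_cpow_le_exp hv0 _).trans ?_
    rw [norm_mul, Complex.norm_two]
    gcongr
  have hlog1 : ‖log v‖ ≤ Real.exp ‖log v‖ := by
    linarith [Real.add_one_le_exp ‖log v‖]
  have hone : 1 ≤ Real.exp ‖log v‖ := Real.one_le_exp hL0
  have key : ∀ x : ℝ, 0 ≤ x → x ≤ Real.exp ‖log v‖ → x * ‖kernel z v‖ ≤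
      C / σ ^ 2 * Real.exp (c * a) * Real.exp (a ^ 2) * Real.exp (-(1 / 4) * v.im ^ 2) := by
    intro x hx0 hx
    rw [kernel, norm_div, div_eq_mul_inv]
    calc x * (‖v ^ (2 * z)‖ * ‖sinh (v ^ 2)‖⁻¹)
        ≤ Real.exp ‖log v‖ * (Real.exp (‖log v‖ * (2 * A)) *
            (C / σ ^ 2 * Real.exp (-v.im ^ 2 / 2))) := by gcongr
      _ = Real.exp (‖log v‖ * a) * (C / σ ^ 2 * Real.exp (-v.im ^ 2 / 2)) := by
          rw [← mul_assoc, ← Real.exp_add]; congr 2; rw [ha]; ring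
      _ ≤ Real.exp (c * a) * (Real.exp (a ^ 2) * Real.exp (v.im ^ 2 / 4)) *
            (C / σ ^ 2 * Real.exp (-v.im ^ 2 / 2)) := by gcongr
      _ = C / σ ^ 2 * Real.exp (c * a) * Real.exp (a ^ 2) *
            (Real.exp (v.im ^ 2 / 4) * Real.exp (-v.im ^ 2 / 2)) := by ring
      _ = _ := by rw [← Real.exp_add]; congr 2; ring
  exact ⟨key _ hL0 hlog1, by simpa using key 1 zero_le_one hone⟩

/-- For `Re z > 1` the kernel has Gaussian decay uniformly in the closed strip, and is small near
the origin. -/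
theorem exists_norm_kernel_le_rpow {σ : ℝ} (hσ : σ < √(Real.pi / 2)) (z : ℂ) :
    ∃ C : ℝ, 0 ≤ C ∧ ∀ v : ℂ, 0 ≤ v.re → v.re ≤ σ → v ≠ 0 →
      ‖kernel z v‖ ≤ C * Real.exp (-v.im ^ 2 / 2) * ‖v‖ ^ (2 * z.re - 2) := by
  obtain ⟨C, hC, hle⟩ := exists_norm_sq_le_norm_sinh hσ
  refine ⟨C * Real.exp (Real.pi * (2 * |z.im|)), by positivity, fun v h0 h1 hv0 => ?_⟩
  have hv : 0 < ‖v‖ := norm_pos_iff.2 hv0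
  have hs := norm_pos_iff.2 (sinh_sq_ne_zero h0 (h1.trans_lt hσ) hv0)
  have hinv : ‖sinh (v ^ 2)‖⁻¹ ≤ C * Real.exp (-v.im ^ 2 / 2) * (‖v‖ ^ 2)⁻¹ := by
    rw [inv_le_iff_one_le_mul₀ hs]
    calc 1 = ‖v‖ ^ 2 / ‖v‖ ^ 2 := by field_simp
      _ ≤ C * Real.exp (-v.im ^ 2 / 2) * ‖sinh (v ^ 2)‖ / ‖v‖ ^ 2 := by
          gcongr; exact hle v h0 h1
      _ = _ := by ring
  have hpow : ‖v ^ (2 * z)‖ ≤ ‖v‖ ^ (2 * z.re) * Real.exp (Real.pi * (2 * |z.im|)) := by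
    rw [norm_cpow_of_ne_zero hv0, div_eq_mul_inv, ← Real.exp_neg]
    simp only [mul_re, re_ofNat, im_ofNat, zero_mul, sub_zero, mul_im, add_zero]
    gcongr
    have h1 : |v.arg * (2 * z.im)| ≤ Real.pi * (2 * |z.im|) := by
      rw [abs_mul, abs_mul, abs_two]
      gcongr
      exact abs_arg_le_pi v
    linarith [neg_abs_le (v.arg * (2 * z.im))]
  rw [kernel, norm_div, div_eq_mul_inv, Real.rpow_sub hv]
  calc ‖v ^ (2 * z)‖ * ‖sinh (v ^ 2)‖⁻¹
      ≤ ‖v‖ ^ (2 * z.re) * Real.exp (Real.pi * (2 * |z.im|)) *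
          (C * Real.exp (-v.im ^ 2 / 2) * (‖v‖ ^ 2)⁻¹) := by gcongr
    _ = _ := by
      rw [Real.rpow_two]; ring

/-! ### Integrability, and reduction of R, D and 𝒳 to the kernel -/

@[simp] theorem w_re (σ t : ℝ) : (w σ t).re = σ := by simp [w]

@[simp] theorem w_im (σ t : ℝ) : (w σ t).im = t := by simp [w]

theorem w_ne_zero {σ : ℝ} (h0 : 0 < σ) (t : ℝ) : w σ t ≠ 0 := fun h => by
  have := congrArg re h
  simp at this
  exact h0.ne' this

@[fun_prop] theorem continuous_w (σ : ℝ) : Continuous (w σ) := by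
  unfold w; fun_prop

@[fun_prop] theorem measurable_kernel (z : ℂ) : Measurable (kernel z) := by
  unfold kernel
  have : Measurable sinh := continuous_sinh.measurable
  fun_prop

theorem integrable_kernel {σ : ℝ} (h0 : 0 < σ) (hσ : σ < √(Real.pi / 2)) (z : ℂ) :
    Integrable (fun t : ℝ => kernel z (w σ t)) := by
  obtain ⟨C, hC⟩ := exists_norm_kernel_le h0 hσ ‖z‖
  refine ((integrable_exp_neg_mul_sq (b := 1 / 4) (by norm_num)).const_mul C).mono'
    ((measurable_kernel z).comp (continuous_w σ).measurable).aestronglyMeasurable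
    (Eventually.of_forall fun t => ?_)
  simpa using (hC z le_rfl (w σ t) (w_re σ t)).2

/-- The integral `∫ w^{2z} / sinh (w²) dt`. -/
noncomputable def kernelIntegral (σ : ℝ) (z : ℂ) : ℂ := ∫ t : ℝ, kernel z (w σ t)

theorem sinh_w_sq_ne_zero {σ : ℝ} (h0 : 0 < σ) (hσ : σ < √(Real.pi / 2)) (t : ℝ) :
    sinh (w σ t ^ 2) ≠ 0 :=
  sinh_sq_ne_zero (by simpa using h0.le) (by simpa using hσ) (w_ne_zero h0 t)

theorem one_sub_exp_mul_one_add_exp (v : ℂ) :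
    (1 - exp v) * (1 + exp v) = -2 * exp v * sinh v := by
  rw [Complex.sinh, exp_neg]
  field_simp [exp_ne_zero v]
  ring

/-- The factor in front of the kernel is bounded on the line because Re w² ≤ σ². Together with its
counterpart for D it sums to -1. -/
theorem integrandR_eq {σ : ℝ} (h0 : 0 < σ) (hσ : σ < √(Real.pi / 2)) (z : ℂ) (t : ℝ) :
    integrandR σ z t = -((1 + exp (w σ t ^ 2)) / 2) * kernel z (w σ t) := by
  have hs := sinh_w_sq_ne_zero h0 hσ t
  have he := one_sub_exp_mul_one_add_exp (w σ t ^ 2)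
  have h1 : 1 - exp (w σ t ^ 2) ≠ 0 := by
    refine left_ne_zero_of_mul (b := 1 + exp (w σ t ^ 2)) ?_
    rw [he]
    exact mul_ne_zero (mul_ne_zero (by norm_num) (exp_ne_zero _)) hs
  rw [integrandR, kernel]
  field_simp
  linear_combination w σ t ^ (2 * z) * he

theorem integrandD_eq {σ : ℝ} (h0 : 0 < σ) (hσ : σ < √(Real.pi / 2)) (z : ℂ) (t : ℝ) :
    integrandD σ z t = -((1 - exp (w σ t ^ 2)) / 2) * kernel z (w σ t) := by
  have hs := sinh_w_sq_ne_zero h0 hσ t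
  have he := one_sub_exp_mul_one_add_exp (w σ t ^ 2)
  have h1 : 1 + exp (w σ t ^ 2) ≠ 0 := by
    refine right_ne_zero_of_mul (a := 1 - exp (w σ t ^ 2)) ?_
    rw [he]
    exact mul_ne_zero (mul_ne_zero (by norm_num) (exp_ne_zero _)) hs
  rw [integrandD, kernel]
  field_simp
  linear_combination w σ t ^ (2 * z) * he

theorem norm_exp_w_sq_le (σ t : ℝ) : ‖exp (w σ t ^ 2)‖ ≤ Real.exp (σ ^ 2) := by
  rw [norm_exp, Real.exp_le_exp]
  simp [pow_two, w]
  exact mul_self_nonneg t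

theorem integrable_integrandR {σ : ℝ} (h0 : 0 < σ) (hσ : σ < √(Real.pi / 2)) (z : ℂ) :
    Integrable (integrandR σ z) := by
  rw [show integrandR σ z = fun t => -((1 + exp (w σ t ^ 2)) / 2) * kernel z (w σ t) from
    funext (integrandR_eq h0 hσ z)]
  refine (integrable_kernel h0 hσ z).bdd_mul (c := (1 + Real.exp (σ ^ 2)) / 2)
    (Continuous.aestronglyMeasurable (by fun_prop)) (Eventually.of_forall fun t => ?_)
  rw [norm_neg, norm_div, Complex.norm_two]
  gcongr
  refine (norm_add_le _ _).trans ?_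
  rw [norm_one]
  gcongr
  exact norm_exp_w_sq_le σ t

theorem integrable_integrandD {σ : ℝ} (h0 : 0 < σ) (hσ : σ < √(Real.pi / 2)) (z : ℂ) :
    Integrable (integrandD σ z) := by
  rw [show integrandD σ z = fun t => -((1 - exp (w σ t ^ 2)) / 2) * kernel z (w σ t) from
    funext (integrandD_eq h0 hσ z)]
  refine (integrable_kernel h0 hσ z).bdd_mul (c := (1 + Real.exp (σ ^ 2)) / 2)
    (Continuous.aestronglyMeasurable (by fun_prop)) (Eventually.of_forall fun t => ?_)
  rw [norm_neg, norm_div, Complex.norm_two]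
  gcongr
  refine (norm_sub_le _ _).trans ?_
  rw [norm_one]
  gcongr
  exact norm_exp_w_sq_le σ t

theorem R_add_D {σ : ℝ} (h0 : 0 < σ) (hσ : σ < √(Real.pi / 2)) (z : ℂ) :
    R σ z + D σ z = -kernelIntegral σ z := by
  rw [R, D, kernelIntegral, ← integral_add (integrable_integrandR h0 hσ z)
    (integrable_integrandD h0 hσ z), ← integral_neg]
  congr 1 with t
  rw [integrandR_eq h0 hσ, integrandD_eq h0 hσ]
  ring

theorem S_eq {σ : ℝ} (h0 : 0 < σ) (hσ : σ < √(Real.pi / 2)) (z : ℂ) :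
    S σ z = (1 / 2) * (kernelIntegral σ (-z) - kernelIntegral σ z) := by
  rw [S]
  linear_combination (1 / 2) * R_add_D h0 hσ z - (1 / 2) * R_add_D h0 hσ (-z)

/-- Re w > 0 keeps 2 arg w inside (-π, π), so squaring does not cross the branch cut. -/
theorem log_w_sq {σ : ℝ} (h0 : 0 < σ) (t : ℝ) : log (w σ t ^ 2) = 2 * log (w σ t) := by
  have harg : |arg (w σ t)| < Real.pi / 2 :=
    abs_arg_lt_pi_div_two_iff.2 (Or.inl (by simpa using h0))
  rw [abs_lt] at harg
  have him : (2 * log (w σ t)).im = 2 * arg (w σ t) := by simp [log_im]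
  rw [← log_exp (x := 2 * log (w σ t)) (by rw [him]; linarith) (by rw [him]; linarith)]
  congr 1
  rw [two_mul, exp_add, exp_log (w_ne_zero h0 t), pow_two]

theorem integrandX_eq {σ : ℝ} (h0 : 0 < σ) (τ : ℂ) (t : ℝ) :
    integrandX σ τ t =
      (I / 2) * (kernel (-(I * τ)) (w σ t) - kernel (I * τ) (w σ t)) := by
  have hw := w_ne_zero h0 t
  rw [integrandX, u, log_w_sq h0, Complex.sin, kernel, kernel, cpow_def_of_ne_zero hw,
    cpow_def_of_ne_zero hw]
  rw [show -(τ * (2 * log (w σ t))) * I = log (w σ t) * (2 * -(I * τ)) by ring,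
    show τ * (2 * log (w σ t)) * I = log (w σ t) * (2 * (I * τ)) by ring]
  ring

theorem integrable_integrandX {σ : ℝ} (h0 : 0 < σ) (hσ : σ < √(Real.pi / 2)) (τ : ℂ) :
    Integrable (integrandX σ τ) := by
  rw [show integrandX σ τ = fun t => (I / 2) * (kernel (-(I * τ)) (w σ t) -
    kernel (I * τ) (w σ t)) from funext (integrandX_eq h0 τ)]
  exact ((integrable_kernel h0 hσ _).sub (integrable_kernel h0 hσ _)).const_mul _

theorem X_eq {σ : ℝ} (h0 : 0 < σ) (hσ : σ < √(Real.pi / 2)) (τ : ℂ) :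
    X σ τ = I * S σ (I * τ) := by
  rw [S_eq h0 hσ, X, kernelIntegral, kernelIntegral, ← integral_sub (integrable_kernel h0 hσ _)
    (integrable_kernel h0 hσ _), ← mul_assoc, ← integral_const_mul]
  congr 1 with t
  rw [integrandX_eq h0]
  ring

/-- Differentiation under the integral sign; the bound on ‖log v‖ ‖kernel‖, uniform for bounded
exponents, dominates the derivative. -/
theorem differentiable_kernelIntegral {σ : ℝ} (h0 : 0 < σ) (hσ : σ < √(Real.pi / 2)) :
    Differentiable ℂ (kernelIntegral σ) := by
  intro z₀
  obtain ⟨C, hC⟩ := exists_norm_kernel_le h0 hσ (‖z₀‖ + 1)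
  have hmeas : Measurable fun t : ℝ => log (w σ t) := (continuous_w σ).measurable.clog
  have h := hasDerivAt_integral_of_dominated_loc_of_deriv_le
    (F := fun (z : ℂ) (t : ℝ) => kernel z (w σ t))
    (F' := fun (z : ℂ) (t : ℝ) => 2 * (log (w σ t) * kernel z (w σ t)))
    (x₀ := z₀) (s := Metric.ball z₀ 1)
    (bound := fun t => 2 * (C * Real.exp (-(1 / 4) * t ^ 2))) (μ := volume)
    (Metric.ball_mem_nhds z₀ one_pos)
    (Eventually.of_forall fun z => (integrable_kernel h0 hσ z).aestronglyMeasurable)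
    (integrable_kernel h0 hσ z₀)
    ((hmeas.mul ((measurable_kernel z₀).comp
      (continuous_w σ).measurable)).const_mul 2).aestronglyMeasurable
    (Eventually.of_forall fun t z hz => ?_)
    (((integrable_exp_neg_mul_sq (b := 1 / 4) (by norm_num)).const_mul C).const_mul 2)
    (Eventually.of_forall fun t z hz => ?_)
  · exact h.2.differentiableAt
  · have hz' : ‖z‖ ≤ ‖z₀‖ + 1 := by
      rw [mem_ball_iff_norm] at hz
      linarith [norm_le_norm_add_norm_sub' z z₀]
    rw [norm_mul, norm_mul, Complex.norm_two]
    exact mul_le_mul_of_nonneg_left (by simpa using (hC z hz' (w σ t) (w_re σ t)).1) zero_le_two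
  · have h1 : HasDerivAt (fun z : ℂ => 2 * z) 2 z := by
      simpa using (hasDerivAt_id z).const_mul (2 : ℂ)
    have h2 := (h1.const_cpow (c := w σ t) (Or.inl (w_ne_zero h0 t))).div_const (sinh (w σ t ^ 2))
    refine h2.congr_deriv ?_
    rw [kernel]
    ring

/-! ### Mellin transform of 1/sinh -/

theorem one_div_two_mul_natCast_cpow (n : ℕ) (s : ℂ) :
    1 / ((2 * n : ℕ) : ℂ) ^ s = 2 ^ (-s) * (1 / (n : ℂ) ^ s) := by
  rw [Nat.cast_mul, natCast_mul_natCast_cpow, cpow_neg, Nat.cast_ofNat, one_div, mul_inv, one_div]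

theorem hasSum_one_div_odd_cpow {s : ℂ} (hs : 1 < s.re) :
    HasSum (fun n : ℕ => 1 / (2 * (n : ℂ) + 1) ^ s) ((1 - 2 ^ (-s)) * riemannZeta s) := by
  have hsum := Complex.summable_one_div_nat_cpow.2 hs
  have hz : HasSum (fun n : ℕ => 1 / (n : ℂ) ^ s) (riemannZeta s) := by
    rw [zeta_eq_tsum_one_div_nat_cpow hs]
    exact hsum.hasSum
  have heven : HasSum (fun n : ℕ => 1 / ((2 * n : ℕ) : ℂ) ^ s) (2 ^ (-s) * riemannZeta s) := by
    rw [funext fun n => one_div_two_mul_natCast_cpow n s]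
    exact hz.mul_left _
  have hodd : Summable fun n : ℕ => 1 / ((2 * n + 1 : ℕ) : ℂ) ^ s :=
    hsum.comp_injective (i := fun n : ℕ => 2 * n + 1) (fun a b h => by simpa using h)
  obtain ⟨m, hm⟩ := hodd
  have hadd := HasSum.even_add_odd (f := fun n : ℕ => 1 / (n : ℂ) ^ s) heven hm
  have hm' : m = (1 - 2 ^ (-s)) * riemannZeta s := by
    linear_combination hadd.unique hz
  rw [hm'] at hm
  simpa only [Nat.cast_add, Nat.cast_mul, Nat.cast_ofNat, Nat.cast_one] using hm

theorem hasSum_exp_odd {t : ℝ} (ht : 0 < t) :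
    HasSum (fun n : ℕ => (2 : ℂ) * (Real.exp (-(2 * (n : ℝ) + 1) * t) : ℂ))
      (((Real.sinh t)⁻¹ : ℝ) : ℂ) := by
  have hlt : Real.exp (-(2 * t)) < 1 := by rw [Real.exp_lt_one_iff]; linarith
  have h := (hasSum_geometric_of_lt_one (Real.exp_pos _).le hlt).mul_left (2 * Real.exp (-t))
  have hval : 2 * Real.exp (-t) * (1 - Real.exp (-(2 * t)))⁻¹ = (Real.sinh t)⁻¹ := by
    have hsinh := Real.sinh_pos_iff.2 ht
    have : 1 - Real.exp (-(2 * t)) = 2 * Real.exp (-t) * Real.sinh t := by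
      rw [Real.sinh_eq, show -(2 * t) = -t + -t by ring, Real.exp_add]
      have : Real.exp (-t) * Real.exp t = 1 := by rw [← Real.exp_add]; simp
      linear_combination -this
    rw [this]
    field_simp
  rw [hval] at h
  have h' := Complex.hasSum_ofReal.2 h
  refine h'.congr_fun fun n => ?_
  push_cast
  rw [mul_assoc, ← Complex.exp_nat_mul, ← Complex.exp_add]
  congr 2
  ring

/-- Termwise transform of 1/sinh t = 2 Σ e^{-(2n+1)t}; the odd Dirichlet series is ζ with its Euler
factor at 2 removed. -/
theorem mellin_inv_sinh {s : ℂ} (hs : 1 < s.re) :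
    mellin (fun t : ℝ => (((Real.sinh t)⁻¹ : ℝ) : ℂ)) s =
      2 * Complex.Gamma s * (1 - 2 ^ (-s)) * riemannZeta s := by
  have h := hasSum_mellin (a := fun _ : ℕ => (2 : ℂ)) (p := fun n : ℕ => 2 * (n : ℝ) + 1)
    (F := fun t : ℝ => (((Real.sinh t)⁻¹ : ℝ) : ℂ)) (s := s)
    (fun n => Or.inr (by positivity)) (by linarith) (fun t ht => hasSum_exp_odd ht) ?_
  · have h2 := (hasSum_one_div_odd_cpow hs).mul_left (2 * Complex.Gamma s)
    refine (h.unique (h2.congr_fun fun n => ?_)).trans (by ring)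
    push_cast
    ring
  · have := ((Real.summable_one_div_nat_rpow.2 hs).comp_injective (i := fun n : ℕ => 2 * n + 1)
      (fun a b h => by simpa using h)).mul_left 2
    refine this.congr fun n => ?_
    simp [div_eq_mul_inv]

theorem integral_Ioi_cpow_div_sinh_sq {z : ℂ} (hz : 1 < z.re) :
    ∫ t : ℝ in Set.Ioi 0, (t : ℂ) ^ (2 * z) * (((Real.sinh (t ^ 2))⁻¹ : ℝ) : ℂ) =
      Complex.Gamma (z + 1 / 2) * (1 - 2 ^ (-(z + 1 / 2))) * riemannZeta (z + 1 / 2) := by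
  have hre : 1 < (z + 1 / 2).re := by simp; linarith
  -- The Mellin weight is t^{s-1}, hence s = 2z + 1; substituting t² halves it to z + 1/2.
  have h := mellin_comp_rpow (fun t : ℝ => (((Real.sinh t)⁻¹ : ℝ) : ℂ)) (2 * z + 1) 2
  rw [show (2 * z + 1) / ((2 : ℝ) : ℂ) = z + 1 / 2 by push_cast; ring, mellin_inv_sinh hre] at h
  simp only [mellin, add_sub_cancel_right, smul_eq_mul, Real.rpow_two] at h
  rw [h, abs_two, real_smul]
  push_cast
  ring

/-! ### The kernel on the imaginary axis -/

theorem kernel_I_mul {z : ℂ} {t : ℝ} (ht : 0 < t) :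
    kernel z (t * I) = -exp (Real.pi * I * z) *
      ((t : ℂ) ^ (2 * z) * (((Real.sinh (t ^ 2))⁻¹ : ℝ) : ℂ)) := by
  have ht0 : (t : ℂ) ≠ 0 := by exact_mod_cast ht.ne'
  have h1 : ((t : ℂ) * I) ^ (2 * z) = (t : ℂ) ^ (2 * z) * exp (Real.pi * I * z) := by
    rw [cpow_def_of_ne_zero (mul_ne_zero ht0 I_ne_zero), cpow_def_of_ne_zero ht0,
      log_ofReal_mul ht I_ne_zero, log_I, ← exp_add, ofReal_log ht.le]
    congr 1
    ring
  have h2 : sinh (((t : ℂ) * I) ^ 2) = -((Real.sinh (t ^ 2) : ℝ) : ℂ) := by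
    rw [mul_pow, I_sq]; push_cast; rw [mul_neg_one, sinh_neg]
  rw [kernel, h1, h2]
  push_cast
  ring

theorem kernel_neg_I_mul {z : ℂ} {t : ℝ} (ht : 0 < t) :
    kernel z ((-t : ℝ) * I) = -exp (-(Real.pi * I * z)) *
      ((t : ℂ) ^ (2 * z) * (((Real.sinh (t ^ 2))⁻¹ : ℝ) : ℂ)) := by
  have ht0 : (t : ℂ) ≠ 0 := by exact_mod_cast ht.ne'
  rw [show (((-t : ℝ) : ℂ) * I) = t * (-I) by push_cast; ring]
  have h1 : ((t : ℂ) * (-I)) ^ (2 * z) = (t : ℂ) ^ (2 * z) * exp (-(Real.pi * I * z)) := by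
    rw [cpow_def_of_ne_zero (mul_ne_zero ht0 (neg_ne_zero.2 I_ne_zero)), cpow_def_of_ne_zero ht0,
      log_ofReal_mul ht (neg_ne_zero.2 I_ne_zero), log_neg_I, ← exp_add, ofReal_log ht.le]
    congr 1
    ring
  have h2 : sinh (((t : ℂ) * (-I)) ^ 2) = -((Real.sinh (t ^ 2) : ℝ) : ℂ) := by
    rw [mul_pow, neg_sq, I_sq]; push_cast; rw [mul_neg_one, sinh_neg]
  rw [kernel, h1, h2]
  push_cast
  ring

/-- The kernel integral along the imaginary axis. -/
theorem integral_kernel_imaginary_axis {z : ℂ} (hz : 1 < z.re)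
    (hint : Integrable fun t : ℝ => kernel z (t * I)) :
    ∫ t : ℝ, kernel z (t * I) = -2 * cos (Real.pi * z) *
      (Complex.Gamma (z + 1 / 2) * (1 - 2 ^ (-(z + 1 / 2))) * riemannZeta (z + 1 / 2)) := by
  have hneg := integral_comp_neg_Ioi (0 : ℝ) (fun t : ℝ => kernel z (t * I))
  rw [neg_zero] at hneg
  rw [← intervalIntegral.integral_Iic_add_Ioi (b := 0) hint.integrableOn hint.integrableOn, ← hneg,
    setIntegral_congr_fun measurableSet_Ioi (fun t ht => kernel_neg_I_mul ht),
    setIntegral_congr_fun measurableSet_Ioi (fun t ht => kernel_I_mul ht),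
    integral_const_mul, integral_const_mul, integral_Ioi_cpow_div_sinh_sq hz, Complex.cos]
  rw [show (Real.pi : ℂ) * z * I = Real.pi * I * z by ring,
    show -((Real.pi : ℂ) * z) * I = -(Real.pi * I * z) by ring]
  ring

/-! ### Moving the contour to the imaginary axis -/

theorem kernel_zero_right (z : ℂ) : kernel z 0 = 0 := by simp [kernel]

/-- Re z > 1 makes the exponent 2 Re z - 2 positive, so the kernel stays bounded at the origin. -/
theorem exists_norm_kernel_le_strip {σ : ℝ} (hσ : σ < √(Real.pi / 2)) {z : ℂ} (hz : 1 < z.re) :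
    ∃ C : ℝ, ∀ v : ℂ, 0 ≤ v.re → v.re ≤ σ →
      ‖kernel z v‖ ≤ C * Real.exp (-(1 / 4) * v.im ^ 2) := by
  obtain ⟨C, hC, hle⟩ := exists_norm_kernel_le_rpow hσ z
  set p := 2 * z.re - 2 with hp
  have hp0 : 0 < p := by linarith
  refine ⟨C * Real.exp (p * σ) * Real.exp (p ^ 2), fun v h0 h1 => ?_⟩
  rcases eq_or_ne v 0 with rfl | hv
  · rw [kernel_zero_right, norm_zero]; positivity
  have hnorm : ‖v‖ ≤ σ + |v.im| := by
    have := norm_le_abs_re_add_abs_im v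
    rw [abs_of_nonneg h0] at this
    linarith
  have hpow : ‖v‖ ^ p ≤ Real.exp (p * σ) * (Real.exp (p ^ 2) * Real.exp (v.im ^ 2 / 4)) := by
    calc ‖v‖ ^ p ≤ Real.exp ‖v‖ ^ p := by
          gcongr
          linarith [Real.add_one_le_exp ‖v‖]
      _ = Real.exp (‖v‖ * p) := (Real.exp_mul _ _).symm
      _ ≤ Real.exp (p * σ + p * |v.im|) := by
          rw [Real.exp_le_exp]; nlinarith
      _ = Real.exp (p * σ) * Real.exp (p * |v.im|) := Real.exp_add _ _
      _ ≤ _ := by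
          gcongr
          exact exp_mul_abs_le p v.im
  calc ‖kernel z v‖ ≤ C * Real.exp (-v.im ^ 2 / 2) * ‖v‖ ^ p := hle v h0 h1 hv
    _ ≤ C * Real.exp (-v.im ^ 2 / 2) *
          (Real.exp (p * σ) * (Real.exp (p ^ 2) * Real.exp (v.im ^ 2 / 4))) := by gcongr
    _ = C * Real.exp (p * σ) * Real.exp (p ^ 2) *
          (Real.exp (-v.im ^ 2 / 2) * Real.exp (v.im ^ 2 / 4)) := by ring
    _ = _ := by rw [← Real.exp_add]; congr 2; ring

theorem differentiableAt_kernel (z : ℂ) {v : ℂ} (h0 : 0 ≤ v.re) (h1 : v.re < √(Real.pi / 2))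
    (hv : v ≠ 0) : DifferentiableAt ℂ (kernel z) v := by
  have hslit : v ∈ slitPlane := by
    rw [mem_slitPlane_iff]
    by_contra! h
    exact hv (Complex.ext (le_antisymm h.1 h0) h.2)
  have hpow : DifferentiableAt ℂ (fun v : ℂ => v ^ (2 * z)) v :=
    (hasStrictDerivAt_id v).hasDerivAt.differentiableAt.cpow_const hslit
  have hsinh : DifferentiableAt ℂ (fun v : ℂ => sinh (v ^ 2)) v := by fun_prop
  exact hpow.div hsinh (sinh_sq_ne_zero h0 h1 hv)

theorem continuousOn_kernel {σ : ℝ} (hσ : σ < √(Real.pi / 2)) {z : ℂ} (hz : 1 < z.re) :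
    ContinuousOn (kernel z) {v | 0 ≤ v.re ∧ v.re ≤ σ} := by
  intro v hv
  rcases eq_or_ne v 0 with rfl | hv0
  · obtain ⟨C, hC, hle⟩ := exists_norm_kernel_le_rpow hσ z
    rw [ContinuousWithinAt, kernel_zero_right]
    have hlim : Tendsto (fun v : ℂ => C * ‖v‖ ^ (2 * z.re - 2)) (𝓝[{v | 0 ≤ v.re ∧ v.re ≤ σ}] 0)
        (𝓝 0) := by
      have : Continuous fun v : ℂ => C * ‖v‖ ^ (2 * z.re - 2) :=
        (continuous_norm.rpow_const fun _ => Or.inr (by linarith)).const_mul C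
      have h := this.tendsto 0
      rw [norm_zero, Real.zero_rpow (by linarith), mul_zero] at h
      exact h.mono_left nhdsWithin_le_nhds
    refine squeeze_zero_norm' ?_ hlim
    filter_upwards [self_mem_nhdsWithin] with v hv
    rcases eq_or_ne v 0 with rfl | hv0
    · rw [kernel_zero_right, norm_zero]; positivity
    refine (hle v hv.1 hv.2 hv0).trans ?_
    gcongr
    refine mul_le_of_le_one_right hC (Real.exp_le_one_iff.2 ?_)
    have := sq_nonneg v.im
    linarith
  · exact (differentiableAt_kernel z hv.1 (hv.2.trans_lt hσ) hv0).continuousAt.continuousWithinAt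

theorem integrable_kernel_strip {σ : ℝ} (hσ : σ < √(Real.pi / 2)) {z : ℂ} (hz : 1 < z.re) {x : ℝ}
    (hx0 : 0 ≤ x) (hx : x ≤ σ) : Integrable fun t : ℝ => kernel z (x + t * I) := by
  obtain ⟨C, hC⟩ := exists_norm_kernel_le_strip hσ hz
  have hcont : Continuous fun t : ℝ => (x : ℂ) + t * I := by fun_prop
  refine ((integrable_exp_neg_mul_sq (b := 1 / 4) (by norm_num)).const_mul C).mono'
    ((measurable_kernel z).comp hcont.measurable).aestronglyMeasurable
    (Eventually.of_forall fun t => ?_)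
  simpa using hC (x + t * I) (by simpa using hx0) (by simpa using hx)

theorem tendsto_integral_kernel_horizontal {σ : ℝ} (h0 : 0 ≤ σ) (hσ : σ < √(Real.pi / 2)) {z : ℂ}
    (hz : 1 < z.re) {y : ℝ → ℝ} (hy : ∀ T, y T ^ 2 = T ^ 2) :
    Tendsto (fun T : ℝ => ∫ x : ℝ in (0 : ℝ)..σ, kernel z (x + (y T : ℂ) * I)) atTop (𝓝 0) := by
  obtain ⟨C, hC⟩ := exists_norm_kernel_le_strip hσ hz
  have hlim : Tendsto (fun T : ℝ => C * Real.exp (-(1 / 4) * T ^ 2) * |σ - 0|) atTop (𝓝 0) := by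
    have h : Tendsto (fun T : ℝ => Real.exp (-(1 / 4) * T ^ 2)) atTop (𝓝 0) :=
      Real.tendsto_exp_atBot.comp
        ((tendsto_pow_atTop two_ne_zero).const_mul_atTop_of_neg (by norm_num))
    simpa using (h.const_mul C).mul_const |σ - 0|
  refine squeeze_zero_norm (fun T => ?_) hlim
  refine intervalIntegral.norm_integral_le_of_norm_le_const fun x hx => ?_
  rw [Set.uIoc_of_le h0] at hx
  have := hC (x + (y T : ℂ) * I) (by simpa using hx.1.le) (by simpa using hx.2)
  simpa [hy T] using this

theorem kernelIntegral_eq_imaginary_axis {σ : ℝ} (h0 : 0 < σ) (hσ : σ < √(Real.pi / 2)) {z : ℂ}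
    (hz : 1 < z.re) : kernelIntegral σ z = ∫ t : ℝ, kernel z (t * I) := by
  have hrect : ∀ T : ℝ,
      (∫ x : ℝ in (0 : ℝ)..σ, kernel z (x + ((-T : ℝ) : ℂ) * I)) -
        (∫ x : ℝ in (0 : ℝ)..σ, kernel z (x + (T : ℂ) * I)) +
        I * (∫ t : ℝ in (-T)..T, kernel z (σ + t * I)) -
        I * (∫ t : ℝ in (-T)..T, kernel z ((0 : ℝ) + t * I)) = 0 := by
    intro T
    -- The origin lies on the left edge, where continuity suffices; listing it as exceptional merely
    -- supplies v ≠ 0.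
    have := integral_boundary_rect_eq_zero_of_differentiable_on_off_countable (kernel z)
      ⟨0, -T⟩ ⟨σ, T⟩ {0} (Set.countable_singleton 0) ?_ ?_
    · simpa only [smul_eq_mul] using this
    · refine (continuousOn_kernel hσ hz).mono fun v hv => ?_
      rw [mem_reProdIm, Set.uIcc_of_le h0.le] at hv
      exact hv.1
    · rintro v ⟨hv, hv0⟩
      rw [mem_reProdIm] at hv
      simp only [min_eq_left h0.le, max_eq_right h0.le] at hv
      exact differentiableAt_kernel z hv.1.1.le (hv.1.2.trans hσ) hv0
  have hvert : ∀ x : ℝ, 0 ≤ x → x ≤ σ →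
      Tendsto (fun T : ℝ => I * ∫ t : ℝ in (-T)..T, kernel z (x + t * I)) atTop
        (𝓝 (I * ∫ t : ℝ, kernel z (x + t * I))) := fun x hx0 hx =>
    (intervalIntegral_tendsto_integral (integrable_kernel_strip hσ hz hx0 hx)
      tendsto_neg_atTop_atBot tendsto_id).const_mul I
  have hlim := (((tendsto_integral_kernel_horizontal h0.le hσ hz (y := fun T => -T)
    (fun T => neg_sq T)).sub (tendsto_integral_kernel_horizontal h0.le hσ hz (y := fun T => T)
    (fun _ => rfl))).add (hvert σ h0.le le_rfl)).sub (hvert 0 le_rfl h0.le)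
  have h := tendsto_nhds_unique hlim (tendsto_const_nhds.congr fun T => (hrect T).symm)
  have h2 : I * ((∫ t : ℝ, kernel z (σ + t * I)) - ∫ t : ℝ, kernel z ((0 : ℝ) + t * I)) = 0 := by
    linear_combination h
  have h3 := sub_eq_zero.1 ((mul_eq_zero.1 h2).resolve_left I_ne_zero)
  simpa only [ofReal_zero, zero_add, kernelIntegral, w] using h3

/-! ### Identification with zeta -/

theorem cos_mul_Gamma_eq {z : ℂ} (hz : 1 < z.re) :
    cos (Real.pi * z) * Complex.Gamma (z + 1 / 2) = Real.pi * (Complex.Gamma (1 / 2 - z))⁻¹ := by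
  have hcos : cos (Real.pi * z) = sin (Real.pi * (z + 1 / 2)) := by
    rw [← Complex.sin_add_pi_div_two]; congr 1; ring
  have hrefl := Complex.Gamma_mul_Gamma_one_sub (z + 1 / 2)
  rw [show 1 - (z + 1 / 2) = 1 / 2 - z by ring, ← hcos] at hrefl
  have hG : Complex.Gamma (z + 1 / 2) ≠ 0 :=
    Complex.Gamma_ne_zero_of_re_pos (by simp; linarith)
  -- If the cosine vanishes, 1/2 - z is a pole of Γ, where `Gamma` takes the value 0; its inverse is
  -- then 0 too, matching the zero of 1/Γ.
  by_cases hc : cos (Real.pi * z) = 0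
  · rw [hc, div_zero, mul_eq_zero] at hrefl
    rw [hc, hrefl.resolve_left hG]
    simp
  · rw [eq_div_iff hc] at hrefl
    have hG' : Complex.Gamma (1 / 2 - z) ≠ 0 := fun h => by
      rw [h] at hrefl
      simp only [mul_zero, zero_mul] at hrefl
      exact Real.pi_ne_zero (ofReal_eq_zero.1 hrefl.symm)
    rw [← div_eq_mul_inv, eq_div_iff hG']
    linear_combination hrefl

/-- Hankel-type representation of the Riemann zeta function on a parabolic contour. -/
theorem kernelIntegral_eq_zeta {σ : ℝ} (h0 : 0 < σ) (hσ : σ < √(Real.pi / 2)) {z : ℂ}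
    (hz : z ≠ 1 / 2) :
    kernelIntegral σ z = -2 * Real.pi * (Complex.Gamma (1 / 2 - z))⁻¹ *
      (1 - 2 ^ (-(z + 1 / 2))) * riemannZeta (z + 1 / 2) := by
  set g : ℂ → ℂ := fun z => -2 * Real.pi * (Complex.Gamma (1 / 2 - z))⁻¹ *
      (1 - 2 ^ (-(z + 1 / 2))) * riemannZeta (z + 1 / 2) with hg
  have hF : AnalyticOnNhd ℂ (kernelIntegral σ) {1 / 2}ᶜ :=
    (differentiable_kernelIntegral h0 hσ).differentiableOn.analyticOnNhd isOpen_compl_singleton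
  have hG : AnalyticOnNhd ℂ g {1 / 2}ᶜ := by
    refine DifferentiableOn.analyticOnNhd (fun v hv => ?_) isOpen_compl_singleton
    have hv' : v + 1 / 2 ≠ 1 := fun h => hv (by
      rw [Set.mem_singleton_iff]; linear_combination h)
    have h1 : DifferentiableAt ℂ (fun z : ℂ => (Complex.Gamma (1 / 2 - z))⁻¹) v :=
      (Complex.differentiable_one_div_Gamma (1 / 2 - v)).comp v (f := fun z : ℂ => 1 / 2 - z)
        (by fun_prop)
    have h2 : DifferentiableAt ℂ (fun z : ℂ => (2 : ℂ) ^ (-(z + 1 / 2))) v :=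
      DifferentiableAt.const_cpow (by fun_prop) (Or.inl two_ne_zero)
    have h3 : DifferentiableAt ℂ (fun z : ℂ => riemannZeta (z + 1 / 2)) v :=
      (differentiableAt_riemannZeta hv').comp v (f := fun z : ℂ => z + 1 / 2) (by fun_prop)
    exact ((((differentiableAt_const _).mul h1).mul
      ((differentiableAt_const _).sub h2)).mul h3).differentiableWithinAt
  -- Removing only the pole of ζ(z + 1/2) leaves a connected domain; the base point 2 lies in the
  -- half-plane of the contour computation.
  have hconn : IsPreconnected ({1 / 2}ᶜ : Set ℂ) :=
    (isConnected_compl_singleton_of_one_lt_rank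
      (by rw [Complex.rank_real_complex]; norm_num) _).isPreconnected
  have hmem : (2 : ℂ) ∈ ({1 / 2}ᶜ : Set ℂ) := by
    rw [Set.mem_compl_singleton_iff]; norm_num
  refine hF.eqOn_of_preconnected_of_eventuallyEq hG hconn hmem ?_ hz
  have hopen : IsOpen {v : ℂ | 1 < v.re} := isOpen_lt continuous_const continuous_re
  filter_upwards [hopen.mem_nhds (show (2 : ℂ) ∈ {v : ℂ | 1 < v.re} by simp)] with v hv
  have hint : Integrable fun t : ℝ => kernel v (t * I) := by
    simpa using integrable_kernel_strip hσ hv le_rfl h0.le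
  rw [kernelIntegral_eq_imaginary_axis h0 hσ hv, integral_kernel_imaginary_axis hv hint, hg]
  linear_combination (-2 * (1 - 2 ^ (-(v + 1 / 2))) * riemannZeta (v + 1 / 2)) *
    cos_mul_Gamma_eq hv

/-! ### Zeros of zeta and zeros of 𝒳 -/

/-- If Re s ≤ 0, then ζ(1 - s) and Γ(1 - s) are nonzero, so in the functional equation only the
cosine can vanish. This makes s = -2k, and k = 0 is excluded by ζ(0) ≠ 0. -/
theorem re_pos_of_zeta_zero {s : ℂ} (hs : riemannZeta s = 0)
    (htriv : ¬∃ n : ℕ, s = -2 * (n + 1)) : 0 < s.re := by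
  by_contra! hle
  have hs0 : s ≠ 0 := by
    rintro rfl
    rw [riemannZeta_zero] at hs
    norm_num at hs
  have hre : 1 ≤ (1 - s).re := by simpa using hle
  have hfe := riemannZeta_one_sub (s := 1 - s)
    (fun n h => by
      rw [h] at hre
      simp at hre
      have : (0 : ℝ) ≤ n := n.cast_nonneg
      linarith)
    (fun h => hs0 (by linear_combination -h))
  rw [sub_sub_cancel, hs] at hfe
  have hpow : (2 * (Real.pi : ℂ)) ^ (-(1 - s)) ≠ 0 := by
    rw [cpow_def_of_ne_zero (mul_ne_zero two_ne_zero (ofReal_ne_zero.2 Real.pi_ne_zero))]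
    exact exp_ne_zero _
  have hcos : cos (Real.pi * (1 - s) / 2) = 0 := by
    by_contra hc
    exact mul_ne_zero (mul_ne_zero (mul_ne_zero (mul_ne_zero two_ne_zero hpow)
      (Complex.Gamma_ne_zero_of_re_pos (by linarith))) hc)
      (riemannZeta_ne_zero_of_one_le_re hre) hfe.symm
  obtain ⟨k, hk⟩ := Complex.cos_eq_zero_iff.1 hcos
  have hpi : (Real.pi : ℂ) ≠ 0 := ofReal_ne_zero.2 Real.pi_ne_zero
  have hsk : s = -2 * k := by
    have : (Real.pi : ℂ) * (1 - s) = Real.pi * (2 * k + 1) := by linear_combination 2 * hk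
    linear_combination -(mul_left_cancel₀ hpi this)
  have hk0 : 1 ≤ k := by
    have h1 : (0 : ℝ) ≤ k := by
      have := hle
      rw [hsk] at this
      simpa using this
    have h2 : k ≠ 0 := by
      rintro rfl
      exact hs0 (by simpa using hsk)
    have h3 : 0 ≤ k := by exact_mod_cast h1
    omega
  obtain ⟨n, hn⟩ := Int.eq_ofNat_of_zero_le (show 0 ≤ k - 1 by omega)
  obtain rfl : k = n + 1 := by omega
  exact htriv ⟨n, by rw [hsk]; push_cast; ring⟩

theorem kernelIntegral_eq_zero_of_zeta_zero {σ : ℝ} (h0 : 0 < σ) (hσ : σ < √(Real.pi / 2)) {s : ℂ}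
    (hs1 : s ≠ 1) (hs : riemannZeta s = 0) : kernelIntegral σ (s - 1 / 2) = 0 := by
  rw [kernelIntegral_eq_zeta h0 hσ (fun h => hs1 (by linear_combination h)), sub_add_cancel, hs,
    mul_zero]

theorem X_eq_zero_of_zeta_zero {σ : ℝ} (h0 : 0 < σ) (hσ : σ < √(Real.pi / 2)) {s : ℂ}
    (hs0 : 0 < s.re) (hs1 : s.re < 1) (hs : riemannZeta s = 0) :
    X σ (-I * (s - 1 / 2)) = 0 := by
  have hne1 : s ≠ 1 := by
    rintro rfl
    simp at hs1
  have hsymm : riemannZeta (1 - s) = 0 := by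
    rw [riemannZeta_one_sub (fun n h => ?_) hne1, hs, mul_zero]
    rw [h] at hs0
    simp at hs0
    have : (0 : ℝ) ≤ n := n.cast_nonneg
    linarith
  have hne0 : 1 - s ≠ 1 := fun h => by
    have : s = 0 := by linear_combination -h
    rw [this] at hs0
    simp at hs0
  have h1 := kernelIntegral_eq_zero_of_zeta_zero h0 hσ hne1 hs
  have h2 := kernelIntegral_eq_zero_of_zeta_zero h0 hσ hne0 hsymm
  rw [show 1 - s - 1 / 2 = -(s - 1 / 2) by ring] at h2
  rw [X_eq h0 hσ, S_eq h0 hσ,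
    show I * (-I * (s - 1 / 2)) = s - 1 / 2 by linear_combination (-(s - 1 / 2)) * I_mul_I, h1, h2]
  ring

end ParabolicMellin

theorem mainTheorem4 (σ : ℝ) (hσ0 : 0 < σ) (hσ1 : σ < Real.sqrt (Real.pi / 2)) :
    -- all the integrals converge absolutely, for every complex argument
    ((∀ z : ℂ, MeasureTheory.Integrable (ParabolicMellin.integrandR σ z)) ∧
      (∀ z : ℂ, MeasureTheory.Integrable (ParabolicMellin.integrandD σ z)) ∧
      (∀ τ : ℂ, MeasureTheory.Integrable (ParabolicMellin.integrandX σ τ))) ∧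
    (∀ τ : ℂ, ParabolicMellin.X σ τ = Complex.I * ParabolicMellin.S σ (Complex.I * τ)) ∧
    ((∀ τ : ℂ, |τ.im| < 1 / 2 → ParabolicMellin.X σ τ = 0 → τ.im = 0) →
      RiemannHypothesis) := by
  refine ⟨⟨ParabolicMellin.integrable_integrandR hσ0 hσ1,
    ParabolicMellin.integrable_integrandD hσ0 hσ1, ParabolicMellin.integrable_integrandX hσ0 hσ1⟩,
    ParabolicMellin.X_eq hσ0 hσ1, fun hreal s hs htriv _ => ?_⟩
  have hpos := ParabolicMellin.re_pos_of_zeta_zero hs htriv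
  have hlt : s.re < 1 := by
    by_contra! h
    exact riemannZeta_ne_zero_of_one_le_re h hs
  -- Rotation by -i turns the signed distance to the critical line into an imaginary part.
  have him : (-I * (s - 1 / 2)).im = 1 / 2 - s.re := by simp
  have h := hreal _ (by rw [him, abs_lt]; constructor <;> linarith)
    (ParabolicMellin.X_eq_zero_of_zeta_zero hσ0 hσ1 hpos hlt hs)
  linarith
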